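/- Let $\mathbb H$ be the real quaternions and, for $n\ge 1$, let $\mathrm{Herm}(n,\mathbb H)$ and $\mathrm{AHerm}(n,\mathbb H)$ be the real vector spaces of $n\times n$ quaternionic matrices $M$ with $M^\dagger=M$ and $M^\dagger=-M$, respectively, where $M^\dagger$ is the conjugate transpose. Call an $\mathbb R$-linear map $\Phi\colon \mathrm{Herm}(n,\mathbb H)\to\mathrm{AHerm}(n,\mathbb H)$ commuting if $H\,\Phi(H)=\Phi(H)\,H$ for all $H\in\mathrm{Herm}(n,\mathbb H)$. Write $\operatorname{tr}(H)=\sum_i H_{ii}$. If $n=1$ or $n=2$, then for every commuting $\mathbb R$-linear map $\Phi$ there is an $A\in\mathrm{AHerm}(n,\mathbb H)$ such that $$\Phi(H)=AH+HA-\operatorname{tr}(H)A\qquad\text{for all } H\in\mathrm{Herm}(n,\mathbb H).$$ Conversely, if $n=1$ or $n=2$, then for every $A\in\mathrm{AHerm}(n,\mathbb H)$ this formula defines an $\mathbb R$-linear map $\mathrm{Herm}(n,\mathbb H)\to\mathrm{AHerm}(n,\mathbb H)$, and this map is commuting. If $n>2$, then the only commuting $\mathbb R$-linear map $\Phi\colon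 \mathrm{Herm}(n,\mathbb H)\to\mathrm{AHerm}(n,\mathbb H)$ is $\Phi=0$. -/

import Mathlib

open scoped Quaternion

/-- The real vector space of self-adjoint `n × n` quaternionic matrices. -/
def QHerm (n : ℕ) : Submodule ℝ (Matrix (Fin n) (Fin n) ℍ[ℝ]) where
  carrier := {M | M.conjTranspose = M}
  zero_mem' := Matrix.conjTranspose_zero
  add_mem' := by
    intro M N hM hN
    simp only [Set.mem_ofPred_eq] at hM hN ⊢
    rw [Matrix.conjTranspose_add, hM, hN]
  smul_mem' := by
    intro c M hM
    simp only [Set.mem_ofPred_eq] at hM ⊢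
    conv_rhs => rw [← hM]
    ext i j <;> simp [Matrix.conjTranspose_apply]

/-- The real vector space of skew-adjoint `n × n` quaternionic matrices. -/
def QAHerm (n : ℕ) : Submodule ℝ (Matrix (Fin n) (Fin n) ℍ[ℝ]) where
  carrier := {M | M.conjTranspose = -M}
  zero_mem' := by simp
  add_mem' := by
    intro M N hM hN
    simp only [Set.mem_ofPred_eq] at hM hN ⊢
    rw [Matrix.conjTranspose_add, hM, hN, neg_add]
  smul_mem' := by
    intro c M hM
    simp only [Set.mem_ofPred_eq] at hM ⊢
    rw [← smul_neg, ← hM]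
    ext i j <;> simp [Matrix.conjTranspose_apply]

/-- A real-linear map from self-adjoint to skew-adjoint matrices is commuting if every `H`
commutes with its image. -/
def IsCommutingMap {n : ℕ} (Φ : QHerm n →ₗ[ℝ] QAHerm n) : Prop :=
  ∀ H : QHerm n,
    (H : Matrix (Fin n) (Fin n) ℍ[ℝ]) * (Φ H : Matrix (Fin n) (Fin n) ℍ[ℝ]) =
      (Φ H : Matrix (Fin n) (Fin n) ℍ[ℝ]) * (H : Matrix (Fin n) (Fin n) ℍ[ℝ])

/-- `Φ(H) = A H + H A - tr(H) A` for all self-adjoint `H`. The scalar `tr(H)` is a quaternion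
acting by left multiplication on the entries of `A`; it is real because `H` is self-adjoint. -/
def HasAnticommutatorForm {n : ℕ} (Φ : QHerm n →ₗ[ℝ] QAHerm n) (A : QAHerm n) : Prop :=
  ∀ H : QHerm n,
    (Φ H : Matrix (Fin n) (Fin n) ℍ[ℝ]) =
      (A : Matrix (Fin n) (Fin n) ℍ[ℝ]) * (H : Matrix (Fin n) (Fin n) ℍ[ℝ]) +
        (H : Matrix (Fin n) (Fin n) ℍ[ℝ]) * (A : Matrix (Fin n) (Fin n) ℍ[ℝ]) -
        (H : Matrix (Fin n) (Fin n) ℍ[ℝ]).trace • (A : Matrix (Fin n) (Fin n) ℍ[ℝ])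

/-! Polarizing `H Φ(H) = Φ(H) H` against `E_ii` shows that each `D_i = Φ(E_ii)` is diagonal and that
the `D_i` determine all off-diagonal entries of `Φ(H)`. Rigidity comes from
`quaternion_eq_zero_of_intertwine`: if `q u = v q` for all `q`, then `u = v` is central, so zero
when imaginary.

For `n > 2` a third index yields such intertwinings, killing the `D_i`, then the diagonal entries of
`Φ` on off-diagonal matrices, then all of `Φ`. For `n = 2` the surviving freedom is two imaginary
quaternions from the `D_i` and one quaternion `β` from `exists_quaternion_of_intertwined`: exactly
the entries of `A`.

Conversely, `[H, AH + HA - tr(H) A] = [H² - tr(H) H, A]`, which vanishes for `n ≤ 2` because `H² -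
tr(H) H` is a real scalar. -/

open Matrix

/-! ### Quaternion identities -/

/-- The quaternion `i`. -/
noncomputable def quatI : ℍ[ℝ] := ⟨0, 1, 0, 0⟩

/-- The quaternion `j`. -/
noncomputable def quatJ : ℍ[ℝ] := ⟨0, 0, 1, 0⟩

/-- The quaternion `k`. -/
noncomputable def quatK : ℍ[ℝ] := ⟨0, 0, 0, 1⟩

@[simp] theorem re_quatI : quatI.re = 0 := rfl
@[simp] theorem imI_quatI : quatI.imI = 1 := rfl
@[simp] theorem imJ_quatI : quatI.imJ = 0 := rfl
@[simp] theorem imK_quatI : quatI.imK = 0 := rfl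
@[simp] theorem re_quatJ : quatJ.re = 0 := rfl
@[simp] theorem imI_quatJ : quatJ.imI = 0 := rfl
@[simp] theorem imJ_quatJ : quatJ.imJ = 1 := rfl
@[simp] theorem imK_quatJ : quatJ.imK = 0 := rfl
@[simp] theorem re_quatK : quatK.re = 0 := rfl
@[simp] theorem imI_quatK : quatK.imI = 0 := rfl
@[simp] theorem imJ_quatK : quatK.imJ = 0 := rfl
@[simp] theorem imK_quatK : quatK.imK = 1 := rfl

/-- A purely imaginary quaternion intertwined with another quaternion by every `q` vanishes,
and so does the other one. -/
theorem quaternion_eq_zero_of_intertwine {u v : ℍ[ℝ]} (hu : u.re = 0)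
    (h : ∀ q : ℍ[ℝ], q * u = v * q) : u = 0 ∧ v = 0 := by
  have huv : u = v := by simpa using h 1
  subst huv
  have hi := h quatI
  have hj := h quatJ
  simp [Quaternion.ext_iff] at hi hj
  have : u = 0 := by
    ext
    · simpa using hu
    · change u.imI = 0; linarith
    · change u.imJ = 0; linarith
    · change u.imK = 0; linarith
  exact ⟨this, this⟩

theorem quaternion_eq_sum_basis (q : ℍ[ℝ]) :
    q = q.re • (1 : ℍ[ℝ]) + q.imI • quatI + q.imJ • quatJ + q.imK • quatK := by
  ext <;> simp

/-- Pairs of real-linear maps from the quaternions to the imaginary quaternions that are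
intertwined pointwise are parametrized by a single quaternion. -/
theorem exists_quaternion_of_intertwined (E F : ℍ[ℝ] →ₗ[ℝ] ℍ[ℝ])
    (hE : ∀ q, (E q).re = 0) (h : ∀ q, q * F q = E q * q) :
    ∃ β : ℍ[ℝ], ∀ q, E q = β * star q - q * star β ∧ F q = star q * β - star β * q := by
  have polar : ∀ q r, q * F r + r * F q = E q * r + E r * q := by
    intro q r
    have := h (q + r)
    simp only [map_add, mul_add, add_mul, h q, h r] at this
    linear_combination (norm := noncomm_ring) this
  obtain ⟨c, hc⟩ : ∃ c, c = E 1 := ⟨_, rfl⟩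
  have hc0 : c.re = 0 := hc ▸ hE 1
  have hF1 : F 1 = c := by simpa [hc] using h 1
  have hFE : ∀ q, F q = E q + c * q - q * c := by
    intro q
    have := polar q 1
    rw [hF1, ← hc] at this
    simp only [one_mul, mul_one] at this
    linear_combination (norm := noncomm_ring) this
  have hcomm : ∀ q r, q * (E r + c * r - r * c) + r * (E q + c * q - q * c) =
      E q * r + E r * q := by
    intro q r
    rw [← hFE, ← hFE, polar]
  -- The target formula forces `β`: at `q = 1` it reads `c = 2 Im β`, and the `i`-part of its value
  -- at `quatI` is `-2 Re β`.
  obtain ⟨β, h0, h1, h2, h3⟩ : ∃ β : ℍ[ℝ], β.re = -(E quatI).imI / 2 ∧ β.imI = c.imI / 2 ∧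
      β.imJ = c.imJ / 2 ∧ β.imK = c.imK / 2 :=
    ⟨⟨-(E quatI).imI / 2, c.imI / 2, c.imJ / 2, c.imK / 2⟩, rfl, rfl, rfl, rfl⟩
  have hE' : ∀ q, E q = β * star q - q * star β := by
    have hII := hcomm quatI quatI
    have hJJ := hcomm quatJ quatJ
    have hKK := hcomm quatK quatK
    have hIJ := hcomm quatI quatJ
    have hIK := hcomm quatI quatK
    have hJK := hcomm quatJ quatK
    simp [Quaternion.ext_iff, hE, hc0] at hII hJJ hKK hIJ hIK hJK
    intro q
    conv_lhs => rw [quaternion_eq_sum_basis q]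
    simp only [map_add, map_smul, ← hc]
    have eI : E quatI = β * star quatI - quatI * star β := by
      ext <;> simp [h0, h1, h2, h3, hE] <;> linarith
    have eJ : E quatJ = β * star quatJ - quatJ * star β := by
      ext <;> simp [h0, h1, h2, h3, hE] <;> linarith
    have eK : E quatK = β * star quatK - quatK * star β := by
      ext <;> simp [h0, h1, h2, h3, hE] <;> linarith
    rw [eI, eJ, eK]
    ext <;> simp [h1, h2, h3, hc0] <;> ring
  refine ⟨β, fun q => ⟨hE' q, ?_⟩⟩
  rw [hFE, hE']
  ext <;> simp [h1, h2, h3, hc0] <;> ring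

/-! ### Indices, matrix units and entries -/

theorem Fin.exists_ne_and_ne {n : ℕ} (hn : 2 < n) (j k : Fin n) : ∃ i, i ≠ j ∧ i ≠ k := by
  by_contra! h
  have hsub : Finset.univ ⊆ ({j, k} : Finset (Fin n)) := fun x _ => by
    simpa [or_iff_not_imp_left] using h x
  have h1 := Finset.card_le_card hsub
  have h2 := Finset.card_le_two (a := j) (b := k)
  rw [Finset.card_univ, Fintype.card_fin] at h1
  omega

theorem single_mul_entry {n : ℕ} (i j a b : Fin n) (c : ℍ[ℝ])
    (M : Matrix (Fin n) (Fin n) ℍ[ℝ]) :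
    (single i j c * M) a b = if a = i then c * M j b else 0 := by
  split_ifs with h
  · subst h; simp
  · simp [h]

theorem mul_single_entry {n : ℕ} (i j a b : Fin n) (c : ℍ[ℝ])
    (M : Matrix (Fin n) (Fin n) ℍ[ℝ]) :
    (M * single i j c) a b = if b = j then M a i * c else 0 := by
  split_ifs with h
  · subst h; simp
  · simp [h]

namespace QHerm

variable {n : ℕ}

/-- The diagonal matrix unit, as a self-adjoint matrix. -/
noncomputable def diagUnit (i : Fin n) : QHerm n :=
  ⟨single i i 1, by change conjTranspose _ = _; simp⟩

/-- The self-adjoint matrix with entry `q` at `(i, j)` and `star q` at `(j, i)`, linear in `q`. -/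
noncomputable def offDiag (i j : Fin n) : ℍ[ℝ] →ₗ[ℝ] QHerm n where
  toFun q := ⟨single i j q + single j i (star q), by
    change conjTranspose _ = _
    simp [add_comm]⟩
  map_add' q r := by
    ext1
    simp only [Submodule.coe_add, star_add, single_add]
    abel
  map_smul' t q := by
    ext1
    simp [smul_single]

theorem coe_diagUnit (i : Fin n) :
    (diagUnit i : Matrix (Fin n) (Fin n) ℍ[ℝ]) = single i i 1 := rfl

theorem coe_offDiag (i j : Fin n) (q : ℍ[ℝ]) :
    (offDiag i j q : Matrix (Fin n) (Fin n) ℍ[ℝ]) = single i j q + single j i (star q) := rfl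

theorem star_apply (H : QHerm n) (i j : Fin n) : star (H.1 j i) = H.1 i j :=
  congrFun (congrFun H.2 i) j

theorem coe_re_apply_self (H : QHerm n) (i : Fin n) : ((H.1 i i).re : ℍ[ℝ]) = H.1 i i :=
  (Quaternion.star_eq_self.mp (star_apply H i i)).symm

end QHerm

namespace QAHerm

variable {n : ℕ}

theorem star_apply (A : QAHerm n) (i j : Fin n) : star (A.1 j i) = -A.1 i j :=
  congrFun (congrFun A.2 i) j

theorem re_apply_self (A : QAHerm n) (i : Fin n) : (A.1 i i).re = 0 := by
  have := congrArg (fun q : ℍ[ℝ] => q.re) (star_apply A i i)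
  simp only [Quaternion.re_star, Quaternion.re_neg] at this
  linarith

end QAHerm

/-! ### Polarization and rigidity -/

namespace IsCommutingMap

open QHerm

variable {n : ℕ} {Φ : QHerm n →ₗ[ℝ] QAHerm n}

theorem polarization (hΦ : IsCommutingMap Φ) (H K : QHerm n) :
    H.1 * (Φ K).1 + K.1 * (Φ H).1 = (Φ H).1 * K.1 + (Φ K).1 * H.1 := by
  have := hΦ (H + K)
  simp only [map_add, Submodule.coe_add, mul_add, add_mul, hΦ H, hΦ K] at this
  linear_combination (norm := noncomm_ring) this

/-- The `(i, j)` entry of the polarized identity at `diagUnit i` and `H`. -/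
theorem entry_diagUnit_left (hΦ : IsCommutingMap Φ) (H : QHerm n) {i j : Fin n} (hij : i ≠ j) :
    (Φ H).1 i j = ((Φ (diagUnit i)).1 * H.1 - H.1 * (Φ (diagUnit i)).1) i j := by
  have := congrFun (congrFun (hΦ.polarization (diagUnit i) H) i) j
  simp only [Matrix.add_apply, coe_diagUnit, single_mul_entry, mul_single_entry, hij.symm, if_true,
    if_false, one_mul, add_zero] at this
  rw [Matrix.sub_apply, ← this]
  abel

/-- Commuting with `E_kk` clears row `k` off the diagonal, and skewness clears column `k`. Elsewhere
`entry_diagUnit_left` applies, with row `i` and column `j` of `E_kk` both zero. -/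
theorem diagUnit_apply_of_ne (hΦ : IsCommutingMap Φ) (k : Fin n) {i j : Fin n} (hij : i ≠ j) :
    (Φ (diagUnit k)).1 i j = 0 := by
  have aux : ∀ l, l ≠ k → (Φ (diagUnit k)).1 k l = 0 := by
    intro l hl
    have := congrFun (congrFun (hΦ (diagUnit k)) k) l
    simpa [coe_diagUnit, single_mul_entry, mul_single_entry, hl] using this
  by_cases hi : i = k
  · subst hi
    exact aux j hij.symm
  by_cases hj : j = k
  · subst hj
    have := QAHerm.star_apply (Φ (diagUnit j)) i j
    rw [aux i hi] at this
    simpa using this.symm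
  rw [hΦ.entry_diagUnit_left _ hij]
  simp [coe_diagUnit, hi, hj]

theorem diagUnit_mul_entry (hΦ : IsCommutingMap Φ) (k i j : Fin n)
    (M : Matrix (Fin n) (Fin n) ℍ[ℝ]) :
    ((Φ (diagUnit k)).1 * M) i j = (Φ (diagUnit k)).1 i i * M i j := by
  rw [mul_apply, Finset.sum_eq_single i]
  · intro l _ hl
    rw [hΦ.diagUnit_apply_of_ne k hl.symm, zero_mul]
  · simp

theorem mul_diagUnit_entry (hΦ : IsCommutingMap Φ) (k i j : Fin n)
    (M : Matrix (Fin n) (Fin n) ℍ[ℝ]) :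
    (M * (Φ (diagUnit k)).1) i j = M i j * (Φ (diagUnit k)).1 j j := by
  rw [mul_apply, Finset.sum_eq_single j]
  · intro l _ hl
    rw [hΦ.diagUnit_apply_of_ne k hl, mul_zero]
  · simp

theorem apply_of_ne (hΦ : IsCommutingMap Φ) (H : QHerm n) {i j : Fin n} (hij : i ≠ j) :
    (Φ H).1 i j =
      (Φ (diagUnit i)).1 i i * H.1 i j - H.1 i j * (Φ (diagUnit i)).1 j j := by
  rw [hΦ.entry_diagUnit_left H hij, Matrix.sub_apply, hΦ.diagUnit_mul_entry, hΦ.mul_diagUnit_entry]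

/-- Polarizing against `E_ii` and against `E_jj` gives two expressions for the same entry of `Φ
(offDiag i j q)`. Equating them for all `q` is an intertwining. -/
theorem diagUnit_apply_other (hΦ : IsCommutingMap Φ) {i j : Fin n} (hij : i ≠ j) :
    (Φ (diagUnit i)).1 j j = -(Φ (diagUnit j)).1 j j := by
  have key : ∀ q : ℍ[ℝ], q * ((Φ (diagUnit i)).1 j j + (Φ (diagUnit j)).1 j j) =
      ((Φ (diagUnit i)).1 i i + (Φ (diagUnit j)).1 i i) * q := by
    intro q
    have h1 := hΦ.apply_of_ne (offDiag i j q) hij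
    have h2 := congrFun (congrFun (hΦ.polarization (diagUnit j) (offDiag i j q)) i) j
    simp only [Matrix.add_apply, coe_diagUnit, single_mul_entry, mul_single_entry, hij, if_true,
      if_false, mul_one, zero_add, hΦ.diagUnit_mul_entry, hΦ.mul_diagUnit_entry] at h2
    have hq : (offDiag i j q).1 i j = q := by simp [coe_offDiag, hij]
    rw [hq] at h1 h2
    rw [h1] at h2
    linear_combination (norm := noncomm_ring) h2
  have := (quaternion_eq_zero_of_intertwine
    (by simp [QAHerm.re_apply_self]) key).1
  exact eq_neg_of_add_eq_zero_left this

theorem diagUnit_eq_zero (hn : 2 < n) (hΦ : IsCommutingMap Φ) (k : Fin n) :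
    Φ (diagUnit k) = 0 := by
  have off : ∀ k j : Fin n, k ≠ j → (Φ (diagUnit k)).1 j j = 0 := by
    intro k j hkj
    -- With `i` and `j` both different from `k`, the terms containing `E_kk` vanish at `(i, j)`.
    obtain ⟨i, hi⟩ := Fin.exists_ne_and_ne hn k j
    have key : ∀ q : ℍ[ℝ], q * (Φ (diagUnit k)).1 j j = (Φ (diagUnit k)).1 i i * q := by
      intro q
      have h2 := congrFun (congrFun (hΦ.polarization (diagUnit k) (offDiag i j q)) i) j
      have hq : (offDiag i j q).1 i j = q := by simp [coe_offDiag, hi.2]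
      simpa [coe_diagUnit, single_mul_entry, mul_single_entry, hi.1, hkj.symm,
        hΦ.diagUnit_mul_entry, hΦ.mul_diagUnit_entry, hq] using h2
    exact (quaternion_eq_zero_of_intertwine (QAHerm.re_apply_self _ _) key).1
  ext1
  ext1 i j
  by_cases hij : i = j
  · subst hij
    by_cases hk : k = i
    · subst hk
      obtain ⟨l, hl⟩ : ∃ l : Fin n, l ≠ k := by
        have : Nontrivial (Fin n) := Fin.nontrivial_iff_two_le.mpr hn.le
        exact exists_ne k
      have := hΦ.diagUnit_apply_other hl
      rw [off l k hl] at this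
      simpa using this.symm
    · simpa using off k i hk
  · simpa using hΦ.diagUnit_apply_of_ne k hij

theorem apply_eq_zero_of_ne (hn : 2 < n) (hΦ : IsCommutingMap Φ) (H : QHerm n) {i j : Fin n}
    (hij : i ≠ j) : (Φ H).1 i j = 0 := by
  simp [hΦ.apply_of_ne H hij, hΦ.diagUnit_eq_zero hn]

/-- All images are diagonal, so the unwanted terms at `(a, b)` each contain `H.1 a b` times a
diagonal entry of `Φ (offDiag a b q)`. The first alternative of `h` handles off-diagonal `H`; the
second then handles every `H`. -/
theorem offDiag_intertwine (hn : 2 < n) (hΦ : IsCommutingMap Φ) (H : QHerm n) {a b : Fin n}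
    (hab : a ≠ b) (q : ℍ[ℝ])
    (h : H.1 a b = 0 ∨ Φ (offDiag a b q) = 0) :
    q * (Φ H).1 b b = (Φ H).1 a a * q := by
  have h2 := congrFun (congrFun (hΦ.polarization (offDiag a b q) H) a) b
  have hl : (H.1 * (Φ (offDiag a b q)).1) a b = 0 := by
    rw [mul_apply, Finset.sum_eq_single b
      (fun l _ hl => by rw [hΦ.apply_eq_zero_of_ne hn _ hl, mul_zero]) (by simp)]
    rcases h with h | h <;> simp [h]
  have hr : ((Φ (offDiag a b q)).1 * H.1) a b = 0 := by
    rw [mul_apply, Finset.sum_eq_single a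
      (fun l _ hl => by rw [hΦ.apply_eq_zero_of_ne hn _ hl.symm, zero_mul])
      (by simp)]
    rcases h with h | h <;> simp [h]
  rw [Matrix.add_apply, Matrix.add_apply, hl, hr] at h2
  simpa [coe_offDiag, add_mul, mul_add, single_mul_entry, mul_single_entry, hab, hab.symm] using h2

theorem eq_zero_of_two_lt (hn : 2 < n) (hΦ : IsCommutingMap Φ) : Φ = 0 := by
  have hoff : ∀ (j k : Fin n) (r : ℍ[ℝ]), j ≠ k → Φ (offDiag j k r) = 0 := by
    intro j k r hjk
    have key : ∀ a b : Fin n, a ≠ b → a ≠ j → a ≠ k →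
        (Φ (offDiag j k r)).1 b b = 0 ∧ (Φ (offDiag j k r)).1 a a = 0 := by
      intro a b hab haj hak
      refine quaternion_eq_zero_of_intertwine (QAHerm.re_apply_self _ _) fun q =>
        hΦ.offDiag_intertwine hn _ hab q (Or.inl ?_)
      simp [coe_offDiag, haj.symm, hak.symm]
    obtain ⟨i, hi⟩ := Fin.exists_ne_and_ne hn j k
    ext1
    ext1 a b
    by_cases hab : a = b
    · subst hab
      by_cases hai : i = a
      · subst hai
        simpa using (key i j hi.1 hi.1 hi.2).2
      · simpa using (key i a hai hi.1 hi.2).1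
    · simpa using hΦ.apply_eq_zero_of_ne hn _ hab
  have : Nontrivial (Fin n) := Fin.nontrivial_iff_two_le.mpr hn.le
  ext1 H
  ext1
  ext1 a b
  by_cases hab : a = b
  · subst hab
    obtain ⟨l, hl⟩ := exists_ne a
    simpa using (quaternion_eq_zero_of_intertwine (QAHerm.re_apply_self (Φ H) _) fun q =>
      hΦ.offDiag_intertwine hn H hl q (Or.inr (hoff l a q hl))).1
  · simpa using hΦ.apply_eq_zero_of_ne hn H hab

end IsCommutingMap

/-! ### Sizes one and two -/

theorem exists_hasAnticommutatorForm_one (Φ : QHerm 1 →ₗ[ℝ] QAHerm 1) :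
    ∃ A : QAHerm 1, HasAnticommutatorForm Φ A := by
  refine ⟨Φ (QHerm.diagUnit 0), fun H => ?_⟩
  have hH : H = (H.1 0 0).re • QHerm.diagUnit 0 := by
    ext1
    ext1 i j
    rw [Subsingleton.elim i 0, Subsingleton.elim j 0]
    simp [QHerm.coe_diagUnit, ← Quaternion.coe_mul_eq_smul, QHerm.coe_re_apply_self]
  have h00 := QHerm.coe_re_apply_self H 0
  conv_lhs => rw [hH]
  ext1 i j
  rw [Subsingleton.elim i 0, Subsingleton.elim j 0]
  simp only [map_smul, Submodule.coe_smul, Matrix.smul_apply, Matrix.add_apply, Matrix.sub_apply,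
    mul_apply, Finset.univ_unique, Finset.sum_singleton, trace, diag_apply, Fin.default_eq_zero,
    Fin.isValue, smul_eq_mul]
  rw [← h00, add_sub_cancel_right, Quaternion.mul_coe_eq_smul]
  simp

theorem QHerm.eq_sum_two (H : QHerm 2) :
    H = (H.1 0 0).re • QHerm.diagUnit 0 + (H.1 1 1).re • QHerm.diagUnit 1 +
      QHerm.offDiag 0 1 (H.1 0 1) := by
  ext1
  ext1 i j
  fin_cases i <;> fin_cases j <;>
    simp [QHerm.coe_diagUnit, QHerm.coe_offDiag, QHerm.star_apply, ← Quaternion.coe_mul_eq_smul,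
      QHerm.coe_re_apply_self]

theorem QAHerm.ext_two {A B : QAHerm 2} (h00 : A.1 0 0 = B.1 0 0) (h01 : A.1 0 1 = B.1 0 1)
    (h11 : A.1 1 1 = B.1 1 1) : A.1 = B.1 := by
  ext1 i j
  fin_cases i <;> fin_cases j
  · exact h00
  · exact h01
  · have hA := QAHerm.star_apply A 1 0
    have hB := QAHerm.star_apply B 1 0
    rw [h01, hB] at hA
    exact (neg_injective hA).symm
  · exact h11

theorem QHerm.trace_smul {n : ℕ} (H : QHerm n) (M : Matrix (Fin n) (Fin n) ℍ[ℝ]) :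
    H.1.trace • M = H.1.trace.re • M := by
  have h : star H.1.trace = H.1.trace := by
    rw [← trace_conjTranspose, show H.1.conjTranspose = H.1 from H.2]
  ext1 i j
  rw [Matrix.smul_apply, Matrix.smul_apply, smul_eq_mul, ← Quaternion.coe_mul_eq_smul,
    ← Quaternion.star_eq_self.mp h]

/-- The map `H ↦ A H + H A - tr(H) A`. -/
noncomputable def anticommutatorMap {n : ℕ} (A : QAHerm n) : QHerm n →ₗ[ℝ] QAHerm n where
  toFun H := ⟨A.1 * H.1 + H.1 * A.1 - H.1.trace.re • A.1, by
    refine sub_mem ?_ ((QAHerm n).smul_mem _ A.2)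
    change conjTranspose _ = _
    rw [conjTranspose_add, conjTranspose_mul, conjTranspose_mul,
      show H.1.conjTranspose = H.1 from H.2, show A.1.conjTranspose = -A.1 from A.2]
    noncomm_ring⟩
  map_add' H K := by
    ext1
    simp only [Submodule.coe_add, mul_add, add_mul, trace_add, Quaternion.re_add, add_smul]
    abel
  map_smul' t H := by
    ext1
    simp [smul_sub, mul_smul]

theorem hasAnticommutatorForm_anticommutatorMap {n : ℕ} (A : QAHerm n) :
    HasAnticommutatorForm (anticommutatorMap A) A := by
  intro H
  rw [QHerm.trace_smul]
  rfl

theorem IsCommutingMap.exists_hasAnticommutatorForm_two {Φ : QHerm 2 →ₗ[ℝ] QAHerm 2}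
    (hΦ : IsCommutingMap Φ) : ∃ A : QAHerm 2, HasAnticommutatorForm Φ A := by
  let entry (i : Fin 2) : ℍ[ℝ] →ₗ[ℝ] ℍ[ℝ] :=
    entryLinearMap ℝ ℍ[ℝ] i i ∘ₗ (QAHerm 2).subtype ∘ₗ Φ ∘ₗ QHerm.offDiag 0 1
  obtain ⟨β, hβ⟩ := exists_quaternion_of_intertwined (entry 0) (entry 1)
    (fun q => QAHerm.re_apply_self _ _) (fun q => by
      have := congrFun (congrFun (hΦ (QHerm.offDiag 0 1 q)) 0) 1
      simpa [entry, QHerm.coe_offDiag, add_mul, mul_add, single_mul_entry, mul_single_entry]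
        using this)
  obtain ⟨α, hα⟩ : ∃ α, α = (Φ (QHerm.diagUnit 0)).1 0 0 := ⟨_, rfl⟩
  obtain ⟨δ, hδ⟩ : ∃ δ, δ = (Φ (QHerm.diagUnit 1)).1 1 1 := ⟨_, rfl⟩
  -- These signs match the target form, which sends the diagonal units to `diag(α, -δ)` and
  -- `diag(-α, δ)`.
  have hα' : (Φ (QHerm.diagUnit 1)).1 0 0 = -α :=
    hα ▸ hΦ.diagUnit_apply_other (by decide)
  have hδ' : (Φ (QHerm.diagUnit 0)).1 1 1 = -δ :=
    hδ ▸ hΦ.diagUnit_apply_other (by decide)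
  have sα : star α = -α := hα ▸ QAHerm.star_apply _ 0 0
  have sδ : star δ = -δ := hδ ▸ QAHerm.star_apply _ 1 1
  let A : QAHerm 2 := ⟨!![α, β; -star β, δ], by
    change conjTranspose _ = _
    ext1 i j
    fin_cases i <;> fin_cases j <;> simp [sα, sδ]⟩
  refine ⟨A, fun H => ?_⟩
  rw [← hasAnticommutatorForm_anticommutatorMap A H]
  obtain ⟨a, ha⟩ : ∃ a, a = (H.1 0 0).re := ⟨_, rfl⟩
  obtain ⟨d, hd⟩ : ∃ d, d = (H.1 1 1).re := ⟨_, rfl⟩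
  obtain ⟨q, hq⟩ : ∃ q, q = H.1 0 1 := ⟨_, rfl⟩
  have hM : H.1 = !![(a : ℍ[ℝ]), q; star q, (d : ℍ[ℝ])] := by
    rw [ha, hd, hq, QHerm.coe_re_apply_self, QHerm.coe_re_apply_self, QHerm.star_apply]
    exact eta_fin_two _
  have hdiag (i : Fin 2) : (Φ H).1 i i = a • (Φ (QHerm.diagUnit 0)).1 i i +
      d • (Φ (QHerm.diagUnit 1)).1 i i + entry i q := by
    conv_lhs => rw [QHerm.eq_sum_two H, ← ha, ← hd, ← hq]
    simp [entry]
  have hform : (anticommutatorMap A H).1 = A.1 * H.1 + H.1 * A.1 - H.1.trace.re • A.1 := rfl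
  have hA : A.1 = !![α, β; -star β, δ] := rfl
  rw [hM, hA] at hform
  apply QAHerm.ext_two
  · rw [hdiag, hform, (hβ q).1, ← hα, hα']
    ext <;> simp [trace, Fin.sum_univ_two] <;> ring
  · rw [hΦ.apply_of_ne H (by decide), hform, ← hq, ← hα, hδ']
    ext <;> simp [trace, Fin.sum_univ_two] <;> ring
  · rw [hdiag, hform, (hβ q).2, ← hδ, hδ']
    ext <;> simp [trace, Fin.sum_univ_two] <;> ring

/-! ### The converse -/

/-- Cayley-Hamilton for self-adjoint matrices of size at most two, up to a central term. -/
theorem QHerm.commute_mul_self_sub_trace {n : ℕ} (hn : n = 1 ∨ n = 2) (H : QHerm n)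
    (A : Matrix (Fin n) (Fin n) ℍ[ℝ]) :
    (H.1 * H.1 - H.1.trace.re • H.1) * A = A * (H.1 * H.1 - H.1.trace.re • H.1) := by
  obtain ⟨t, ht⟩ : ∃ t : ℝ, H.1 * H.1 - H.1.trace.re • H.1 = t • 1 := by
    rcases hn with rfl | rfl
    · refine ⟨0, ?_⟩
      ext1 i j
      rw [Subsingleton.elim i 0, Subsingleton.elim j 0]
      rw [← QHerm.trace_smul]
      simp [mul_apply, trace]
    -- The scalar is minus the determinant `ad - |q|²`.
    · refine ⟨-((H.1 0 0).re * (H.1 1 1).re - Quaternion.normSq (H.1 0 1)), ?_⟩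
      have h0 := QHerm.coe_re_apply_self H 0
      have h1 := QHerm.coe_re_apply_self H 1
      have h10 := QHerm.star_apply H 1 0
      obtain ⟨a, ha⟩ : ∃ a, a = (H.1 0 0).re := ⟨_, rfl⟩
      obtain ⟨d, hd⟩ : ∃ d, d = (H.1 1 1).re := ⟨_, rfl⟩
      obtain ⟨q, hq⟩ : ∃ q, q = H.1 0 1 := ⟨_, rfl⟩
      have hM : H.1 = !![(a : ℍ[ℝ]), q; star q, (d : ℍ[ℝ])] := by
        rw [ha, hd, hq, h0, h1, h10]
        exact eta_fin_two _
      rw [← ha, ← hd, ← hq, hM]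
      ext i j <;> fin_cases i <;> fin_cases j <;>
        simp [Fin.sum_univ_two, trace, Quaternion.normSq_def'] <;> ring
  rw [ht]
  simp

theorem HasAnticommutatorForm.isCommutingMap {n : ℕ} (hn : n = 1 ∨ n = 2)
    {A : QAHerm n} {Φ : QHerm n →ₗ[ℝ] QAHerm n} (h : HasAnticommutatorForm Φ A) :
    IsCommutingMap Φ := by
  intro H
  rw [h H, QHerm.trace_smul]
  have := QHerm.commute_mul_self_sub_trace hn H A.1
  simp only [sub_mul, mul_sub, smul_mul_assoc, mul_smul_comm] at this
  simp only [sub_mul, mul_sub, mul_add, add_mul, smul_mul_assoc, mul_smul_comm]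
  linear_combination (norm := noncomm_ring) this

theorem theorem3 (n : ℕ) :
    ((n = 1 ∨ n = 2) →
      (∀ Φ : QHerm n →ₗ[ℝ] QAHerm n, IsCommutingMap Φ →
        ∃ A : QAHerm n, HasAnticommutatorForm Φ A) ∧
      (∀ A : QAHerm n, ∃ Φ : QHerm n →ₗ[ℝ] QAHerm n, HasAnticommutatorForm Φ A) ∧
      (∀ (A : QAHerm n) (Φ : QHerm n →ₗ[ℝ] QAHerm n),
        HasAnticommutatorForm Φ A → IsCommutingMap Φ)) ∧
    (2 < n → ∀ Φ : QHerm n →ₗ[ℝ] QAHerm n, IsCommutingMap Φ → Φ = 0) := by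
  refine ⟨fun hn => ⟨?_, fun A => ⟨_, hasAnticommutatorForm_anticommutatorMap A⟩,
    fun A Φ h => h.isCommutingMap hn⟩, fun hn Φ hΦ => hΦ.eq_zero_of_two_lt hn⟩
  rcases hn with rfl | rfl
  · exact fun Φ _ => exists_hasAnticommutatorForm_one Φ
  · exact fun Φ hΦ => hΦ.exists_hasAnticommutatorForm_two
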